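/- **Lemma 5.5.** *Set-up.* Let $n\ge 0$ and $P=\{x\in\mathbb R^n : x^i\ge 0,\ \sum_i x^i\le 2\}$, the polytope of $\mathbb CP^n$, with $x^0:=2-\sum_{i\ge1} x^i$. Let $g$ be the metric $g(\xi,\zeta)=\frac12\sum_{i=0}^n \xi^i\zeta^i/x^i$ (with $\xi^0:=-\sum_{i\ge 1}\xi^i$, $\zeta^0:=-\sum_{i\ge1}\zeta^i$; on a face of $P$ its restriction to the face), $\omega=\sum_{i,j} g_{ij}\,dx^i\wedge dy^j$ the symplectic form on $P\times(\mathbb R/\mathbb Z)^n$, and, for $a\in\mathbb Z$, $L_a=\{y=s_a(x)\}$ with $s_a(x)=\frac a2x$ the Lagrangian section corresponding to $\mathcal O(a)$, with lifts $s_{a,I}=s_a-I$, $I\in\mathbb Z^n$. For lifts $s,s'$ the gradient vector field $-\mathrm{grad}(f_s-f_{s'})$ is $\sum_j (s'^j-s^j)\,\partial/\partial x^j$. $\mathit{Mo}(P)(L_a,L_b)$ is the complex vector space spanned by the connected components $V$ of $\pi(L_a\cap L_b)\subset P$ which contain a point $v$ that is interior to $S_v\cap P$ in $S_v$, where $S_v\subset\mathbb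 R^n$ is the stable manifold of $v$; the degree is $|V|=\dim S_v$. For $a<b$ these generators are the points $V_{ab;I}=\{v_{ab;I}\}$, $v_{ab;I}=\frac{2}{b-a}I$, where $I\in\mathbb Z_{\ge 0}^n$, $|I|=\sum_j i_j\le b-a$, and they have degree $0$. A gradient tree $\gamma$ from generators $V,W$ of $\mathit{Mo}(P)(L_a,L_b)$, $\mathit{Mo}(P)(L_b,L_c)$ to a generator $U$ of $\mathit{Mo}(P)(L_a,L_c)$ is a choice of lifts $s_a$, $s_{b,p}$, $s_{c,q}$ together with trajectories in $P$ of $-\mathrm{grad}(f_{s_a}-f_{s_{b,p}})$ and of $-\mathrm{grad}(f_{s_{b,p}}-f_{s_{c,q}})$ over $(-\infty,0]$, starting (as $t\to-\infty$) at a point of $V$, respectively of $W$, and a trajectory in $P$ of $-\mathrm{grad}(f_{s_a}-f_{s_{c,q}})$ over $[0,\infty)$, ending (as $t\to\infty$) at a point of $U$, such that the three meet at $t=0$. Its area $A(\gamma)\in[0,\infty]$ is the sum of the symplectic areas of the three strips over its edges between the two lifts in question. For $a<b<c$ the product is $$m_2(V,W)=\sum_{U}\ \sum_{[\gamma]} e^{-A(\gamma)}\,U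 ,$$ where $U$ runs over the generators of $\mathit{Mo}(P)(L_a,L_c)$ of degree $|V|+|W|$ and $[\gamma]$ over the smooth homotopy classes of gradient trees from $V,W$ to $U$. On the other side, let $\check M=(\mathbb C^\times)^n\subset\mathbb CP^n$ with coordinates $w_j=t_j/t_0=|w_j|e^{\mathbf i y_j}$, $\Psi_a=(1+\sum_j|w_j|^2)^{a/2}$ and $x^i=2|w_i|^2/(1+\sum_j|w_j|^2)$. The degree $0$ part of $\mathcal V'(\mathcal O(a),\mathcal O(b))$ consists of the functions $\Psi_b^{-1}\tilde\psi\Psi_a$ on $\check M$, where $\tilde\psi$ is a smooth bundle morphism $\mathcal O(a)\to\mathcal O(b)$ over $\mathbb CP^n$, and composition is the product of functions. It contains $$\mathbf e_{ab;I}=c_{ab;I}\Big(\sqrt{x^0/2}\Big)^{b-a-|I|}\prod_{j=1}^n\Big(\sqrt{x^j/2}\,e^{\mathbf i y_j}\Big)^{i_j},$$ where the constant $c_{ab;I}>0$ is such that $\max_P|\mathbf e_{ab;I}|=1$. For $a<b$ let $\iota$ be the linear map with $\iota(V_{ab;I})=\mathbf e_{ab;I}$. *Statement.* Let $a<b<c$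 be integers and let $I,J\in\mathbb Z_{\ge0}^n$ with $|I|\le b-a$, $|J|\le c-b$. Then $$\iota\big(m_2(V_{ab;I},V_{bc;J})\big)=\mathbf e_{ab;I}\cdot\mathbf e_{bc;J}.$$ More precisely, $v_{ac;I+J}$ lies on the segment from $v_{ab;I}$ to $v_{bc;J}$; there is exactly one gradient tree $\gamma$ that starts at $V_{ab;I}$, $V_{bc;J}$ and ends at any generator of $\mathit{Mo}(P)(L_a,L_c)$; it ends at $V_{ac;I+J}$, its two leaf edges (with their starting points) are the segments from $v_{ab;I}$ and from $v_{bc;J}$ to $v_{ac;I+J}$, and its root edge is constant at $v_{ac;I+J}$. Moreover $A(\gamma)<\infty$, $m_2(V_{ab;I},V_{bc;J})=e^{-A(\gamma)}\,V_{ac;I+J}$ and $\mathbf e_{ab;I}\cdot\mathbf e_{bc;J}=e^{-A(\gamma)}\,\mathbf e_{ac;I+J}$. -/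

import Mathlib

open Set Filter Topology
open scoped ENNReal ContDiff

namespace MorseCPn

noncomputable section

variable {n : ℕ}

/-! ## The polytope, the Lagrangian sections and the symplectic form -/

/-- The dual polytope `P` of `ℂPⁿ` in the dual coordinates `(x¹, …, xⁿ)`; its interior is `B`. -/
def polytope (n : ℕ) : Set (Fin n → ℝ) := {x | (∀ i, 0 ≤ x i) ∧ ∑ i, x i ≤ 2}

/-- The lift `y = (a/2) x - I` of the Lagrangian section `L_a`; for `I = 0` this is `s_a`, and in
general it is `s_{a,I}`. The formula also extends the section from `P` to `B̃ = ℝⁿ`. -/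
def sLift (a : ℤ) (I : Fin n → ℤ) (x : Fin n → ℝ) : Fin n → ℝ :=
  fun j => (a : ℝ) / 2 * x j - I j

/-- The Lagrangian `L_a` over `P`, in the trivial torus fibration `P × (ℝ/ℤ)ⁿ`. -/
def lagrangian (n : ℕ) (a : ℤ) : Set ((Fin n → ℝ) × (Fin n → UnitAddCircle)) :=
  {p | p.1 ∈ polytope n ∧ ∀ j, p.2 j = ((sLift a 0 p.1 j : ℝ) : UnitAddCircle)}

/-- `π(L_a ∩ L_b) ⊆ P`. -/
def intersection (n : ℕ) (a b : ℤ) : Set (Fin n → ℝ) :=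
  Prod.fst '' (lagrangian n a ∩ lagrangian n b)

/-- The Hessian metric `∑ g_{ij} dxⁱ dxʲ` on `P`. Since
`xⁱ = 2 exp(2 x_i) / (1 + ∑ exp(2 x_j))`, we have `x_j = (log xʲ - log (2 - ∑ xⁱ)) / 2`, so that
`g(ξ, ζ) = ∑ dx_j(ξ) ζʲ` is given by the formula below. The metric diverges at the boundary of `P`
in the directions normal to the faces. For vectors tangent to a face the terms in question are
`0 / 0 = 0` here, so that the formula gives the limit of the metric, restricted to the face. -/
def hessianMetric (x ξ ζ : Fin n → ℝ) : ℝ :=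
  1 / 2 * (∑ i, ξ i * ζ i / x i + (∑ i, ξ i) * (∑ i, ζ i) / (2 - ∑ i, x i))

/-- The symplectic form `∑ g_{ij} dxⁱ ∧ dyʲ` at a point over `x`, on the tangent vectors
`u = (ξ, η)`, `v = (ξ', η')`, where `ξ` is the `x`-part and `η` is the `y`-part. -/
def symplecticForm (x : Fin n → ℝ) (u v : (Fin n → ℝ) × (Fin n → ℝ)) : ℝ :=
  hessianMetric x u.1 v.2 - hessianMetric x v.1 u.2

/-! ## Gradient flows and the generators of the spaces of morphisms -/

/-- The vector field `-grad(f_s - f_{s'})` for lifts `s`, `s'` of Lagrangian sections. As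
`df_s = ∑ sʲ dx_j` and `grad f = ∑ (∂f/∂x_j) ∂/∂xʲ`, its components in the coordinates `xʲ` are
`s'ʲ - sʲ`. -/
def negGrad (s s' : (Fin n → ℝ) → (Fin n → ℝ)) (x : Fin n → ℝ) : Fin n → ℝ := s' x - s x

/-- The stable manifold in `B̃ = ℝⁿ` of the point `v` for the vector field `-grad(f_s - f_{s'})`. -/
def stableManifold (s s' : (Fin n → ℝ) → (Fin n → ℝ)) (v : Fin n → ℝ) : Set (Fin n → ℝ) :=
  {x | ∃ γ : ℝ → (Fin n → ℝ), γ 0 = x ∧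
    (∀ t ∈ Ici (0 : ℝ), HasDerivWithinAt γ (negGrad s s' (γ t)) (Ici 0) t) ∧
    Tendsto γ atTop (𝓝 v)}

/-- A generator of `Mo(P)(L_a, L_b)`: a connected component `V` of `π(L_a ∩ L_b)` such that some
point `v ∈ V` is an interior point of `S_v ∩ P ⊆ S_v`. The `ℤⁿ`-grading `label` is recorded too: it
is the `I` for which `V` lies in the image of `graph(s_a) ∩ graph(s_{b,I})`, and it is determined by
`V`, which is not empty. -/
@[ext]
structure Gen (n : ℕ) (a b : ℤ) where
  /-- the component -/
  carrier : Set (Fin n → ℝ)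
  /-- its `ℤⁿ`-grading -/
  label : Fin n → ℤ
  isComponent : ∃ x ∈ intersection n a b, carrier = connectedComponentIn (intersection n a b) x
  graded : ∀ x ∈ carrier, sLift a 0 x = sLift b label x
  interior : ∃ v ∈ carrier, polytope n ∈ 𝓝[stableManifold (sLift a 0) (sLift b label) v] v

theorem Gen.nonempty {a b : ℤ} (V : Gen n a b) : V.carrier.Nonempty := by
  obtain ⟨x, hx, h⟩ := V.isComponent
  exact ⟨x, h ▸ mem_connectedComponentIn hx⟩

theorem Gen.subset {a b : ℤ} (V : Gen n a b) : V.carrier ⊆ intersection n a b := by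
  obtain ⟨x, hx, h⟩ := V.isComponent
  exact h ▸ connectedComponentIn_subset _ _

/-- The degree `|V|`: the dimension of the stable manifold `S_v` of a point `v ∈ V`. The vector
fields are affine, so `S_v` is an affine subspace of `ℝⁿ`. -/
def Gen.degree {a b : ℤ} (V : Gen n a b) : ℕ :=
  Module.finrank ℝ
    (vectorSpan ℝ (stableManifold (sLift a 0) (sLift b V.label) V.nonempty.some))

/-- The space of morphisms `Mo(P)(L_a, L_b)`, spanned by the generators. -/
abbrev Mo (n : ℕ) (a b : ℤ) : Type := Gen n a b →₀ ℂ

/-! ## Gradient trees and the product `m₂` -/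

/-- `γ` is a trajectory in `P` of the vector field `X`, over the time interval `D`. -/
def IsTrajectory (X : (Fin n → ℝ) → (Fin n → ℝ)) (D : Set ℝ) (γ : ℝ → (Fin n → ℝ)) : Prop :=
  ∀ t ∈ D, γ t ∈ polytope n ∧ HasDerivWithinAt γ (X (γ t)) D t

/-- The gradient trees with leaves on `V`, `W` and root on `U`. The trivalent `2`-tree has one
interior vertex and three edges. The leaf edges are trajectories over `(-∞, 0]` which start (as
`t → -∞`) at points of `V` and `W`, the root edge is a trajectory over `[0, ∞)` which ends at a point
of `U`, and the three of them meet at time `0`. The vector fields are the ones of lifts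
`s_a`, `s_b - shift₁`, `s_c - shift₂` of the three Lagrangians along the tree. Only the restrictions
of the three curves to the time intervals matter. -/
structure GradTree {a b c : ℤ} (V : Gen n a b) (W : Gen n b c) (U : Gen n a c) where
  shift₁ : Fin n → ℤ
  shift₂ : Fin n → ℤ
  leaf₁ : Fin n → ℝ
  leaf₂ : Fin n → ℝ
  root : Fin n → ℝ
  leafEdge₁ : ℝ → (Fin n → ℝ)
  leafEdge₂ : ℝ → (Fin n → ℝ)
  rootEdge : ℝ → (Fin n → ℝ)
  leaf₁_mem : leaf₁ ∈ V.carrier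
  leaf₂_mem : leaf₂ ∈ W.carrier
  root_mem : root ∈ U.carrier
  trajectory₁ : IsTrajectory (negGrad (sLift a 0) (sLift b shift₁)) (Iic 0) leafEdge₁
  trajectory₂ : IsTrajectory (negGrad (sLift b shift₁) (sLift c shift₂)) (Iic 0) leafEdge₂
  trajectory₀ : IsTrajectory (negGrad (sLift a 0) (sLift c shift₂)) (Ici 0) rootEdge
  tendsto₁ : Tendsto leafEdge₁ atBot (𝓝 leaf₁)
  tendsto₂ : Tendsto leafEdge₂ atBot (𝓝 leaf₂)
  tendsto₀ : Tendsto rootEdge atTop (𝓝 root)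
  meet₁ : leafEdge₁ 0 = rootEdge 0
  meet₂ : leafEdge₂ 0 = rootEdge 0

variable {a b c : ℤ} {V : Gen n a b} {W : Gen n b c} {U : Gen n a c}

/-- Two gradient trees (with the same leaf generators) are equal as maps on the tree. -/
def GradTree.Same {U' : Gen n a c} (γ : GradTree V W U) (γ' : GradTree V W U') : Prop :=
  γ.shift₁ = γ'.shift₁ ∧ γ.shift₂ = γ'.shift₂ ∧
  γ.leaf₁ = γ'.leaf₁ ∧ γ.leaf₂ = γ'.leaf₂ ∧ γ.root = γ'.root ∧
  EqOn γ.leafEdge₁ γ'.leafEdge₁ (Iic 0) ∧ EqOn γ.leafEdge₂ γ'.leafEdge₂ (Iic 0) ∧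
  EqOn γ.rootEdge γ'.rootEdge (Ici 0)

/-- Smooth homotopy of gradient trees: a family of gradient trees, parametrized by `[0, 1]`, which is
smooth along each edge, and continuous up to the leaves and the root. -/
def GradTree.Homotopic (γ γ' : GradTree V W U) : Prop :=
  ∃ Γ : ℝ → GradTree V W U, (Γ 0).Same γ ∧ (Γ 1).Same γ' ∧
    ContDiffOn ℝ ∞ (fun p : ℝ × ℝ => (Γ p.1).leafEdge₁ p.2) (Icc 0 1 ×ˢ Iic 0) ∧
    ContDiffOn ℝ ∞ (fun p : ℝ × ℝ => (Γ p.1).leafEdge₂ p.2) (Icc 0 1 ×ˢ Iic 0) ∧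
    ContDiffOn ℝ ∞ (fun p : ℝ × ℝ => (Γ p.1).rootEdge p.2) (Icc 0 1 ×ˢ Ici 0) ∧
    TendstoUniformlyOn (fun t τ => (Γ τ).leafEdge₁ t) (fun τ => (Γ τ).leaf₁) atBot (Icc 0 1) ∧
    TendstoUniformlyOn (fun t τ => (Γ τ).leafEdge₂ t) (fun τ => (Γ τ).leaf₂) atBot (Icc 0 1) ∧
    TendstoUniformlyOn (fun t τ => (Γ τ).rootEdge t) (fun τ => (Γ τ).root) atTop (Icc 0 1)

/-- `HGT(V, W; U)`, the set of smooth homotopy classes of gradient trees. -/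
abbrev HGT (V : Gen n a b) (W : Gen n b c) (U : Gen n a c) : Type :=
  Quot (GradTree.Homotopic (V := V) (W := W) (U := U))

/-- The strip over the curve `γ` between the graphs of `s` and `s'`, parametrized by the time `t`
and by `u ∈ [0, 1]`. -/
def strip (s s' : (Fin n → ℝ) → (Fin n → ℝ)) (γ : ℝ → (Fin n → ℝ)) (t u : ℝ) :
    (Fin n → ℝ) × (Fin n → ℝ) :=
  (γ t, (1 - u) • s (γ t) + u • s' (γ t))

/-- The symplectic area in `[0, ∞]` of the strip over a trajectory `γ` of `-grad(f_s - f_{s'})`. The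
symplectic form is nonnegative on such strips, its value on `(∂_t, ∂_u)` being `g(γ', γ')`. -/
def stripArea (s s' : (Fin n → ℝ) → (Fin n → ℝ)) (γ : ℝ → (Fin n → ℝ)) (D : Set ℝ) : ℝ≥0∞ :=
  ∫⁻ t in D, ∫⁻ u in Icc (0 : ℝ) 1, ENNReal.ofReal
    (symplecticForm (γ t) (deriv (fun τ => strip s s' γ τ u) t) (deriv (strip s s' γ t) u))

/-- The symplectic area `A(γ) ∈ [0, ∞]` of the piecewise smooth disk over the gradient tree `γ`,
which is bounded by the lifts of the three Lagrangians. -/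
def GradTree.area (γ : GradTree V W U) : ℝ≥0∞ :=
  stripArea (sLift a 0) (sLift b γ.shift₁) γ.leafEdge₁ (Iic 0) +
  stripArea (sLift b γ.shift₁) (sLift c γ.shift₂) γ.leafEdge₂ (Iic 0) +
  stripArea (sLift a 0) (sLift c γ.shift₂) γ.rootEdge (Ici 0)

/-- The weight `exp(-A(γ))`, which is `0` if `A(γ) = ∞`. -/
def GradTree.weight (γ : GradTree V W U) : ℝ := (EReal.exp (-(γ.area : EReal))).toReal

/-- `m₂(V, W) = ∑_U ∑_{[γ] ∈ HGT(V, W; U)} exp(-A(γ)) U`, over the generators `U` of degree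
`|V| + |W|`. For `a < b < c` all generators have degree zero, so that all signs are `+`. -/
def m₂Gen (_ : a < b) (_ : b < c) (V : Gen n a b) (W : Gen n b c) : Mo n a c :=
  ∑ᶠ (U : Gen n a c) (_ : U.degree = V.degree + W.degree), ∑ᶠ g : HGT V W U,
    Finsupp.single U ((Quot.out g).weight : ℂ)

/-- The bilinear product `m₂ : Mo(P)(L_a, L_b) ⊗ Mo(P)(L_b, L_c) → Mo(P)(L_a, L_c)`, `a < b < c`. -/
def m₂ (hab : a < b) (hbc : b < c) : Mo n a b →ₗ[ℂ] Mo n b c →ₗ[ℂ] Mo n a c :=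
  Finsupp.linearCombination ℂ fun V => Finsupp.linearCombination ℂ fun W => m₂Gen hab hbc V W

/-! ## The point generators -/

/-- The index set of the bases: `i_j ≥ 0` and `i_1 + … + i_n ≤ b - a`. -/
def IsIndex (a b : ℤ) (I : Fin n → ℤ) : Prop := (∀ j, 0 ≤ I j) ∧ ∑ j, I j ≤ b - a

theorem IsIndex.add {I J : Fin n → ℤ} (hI : IsIndex a b I) (hJ : IsIndex b c J) :
    IsIndex a c (I + J) := by
  refine ⟨fun j => add_nonneg (hI.1 j) (hJ.1 j), ?_⟩
  have h1 := hI.2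
  have h2 := hJ.2
  simp only [Pi.add_apply, Finset.sum_add_distrib]
  linarith

/-- The point `v_{ab;I} = (2 i_1 / (b - a), …, 2 i_n / (b - a))`. -/
def vpt (a b : ℤ) (I : Fin n → ℤ) : Fin n → ℝ := fun j => 2 * (I j : ℝ) / ((b : ℝ) - a)

theorem mem_intersection {x : Fin n → ℝ} :
    x ∈ intersection n a b ↔ x ∈ polytope n ∧ ∃ I : Fin n → ℤ, sLift a 0 x = sLift b I x := by
  constructor
  · rintro ⟨p, ⟨⟨hP, ha⟩, ⟨_, hb⟩⟩, rfl⟩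
    refine ⟨hP, ?_⟩
    have h : ∀ j, ∃ m : ℤ, (m : ℝ) = sLift b 0 p.1 j - sLift a 0 p.1 j := by
      intro j
      have h1 : ((sLift b 0 p.1 j - sLift a 0 p.1 j : ℝ) : UnitAddCircle) = 0 := by
        rw [AddCircle.coe_sub, ← ha j, ← hb j, sub_self]
      obtain ⟨m, hm⟩ := (AddCircle.coe_eq_zero_iff _).1 h1
      exact ⟨m, by simpa using hm⟩
    choose I hI using h
    refine ⟨I, funext fun j => ?_⟩
    have := hI j
    simp only [sLift, Pi.zero_apply, Int.cast_zero] at this ⊢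
    linarith
  · rintro ⟨hP, I, hI⟩
    refine ⟨(x, fun j => ((sLift a 0 x j : ℝ) : UnitAddCircle)), ⟨⟨hP, fun j => rfl⟩, hP, ?_⟩, rfl⟩
    intro j
    have h1 : sLift b 0 x j - sLift a 0 x j = I j := by
      have := congrFun hI j
      simp only [sLift, Pi.zero_apply, Int.cast_zero] at this ⊢
      linarith
    have h2 : ((sLift b 0 x j - sLift a 0 x j : ℝ) : UnitAddCircle) = 0 :=
      (AddCircle.coe_eq_zero_iff _).2 ⟨I j, by simp [h1]⟩
    rw [AddCircle.coe_sub, sub_eq_zero] at h2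
    exact h2.symm

theorem sLift_eq_iff (hab : a < b) {I : Fin n → ℤ} {x : Fin n → ℝ} :
    sLift a 0 x = sLift b I x ↔ x = vpt a b I := by
  have h : (0 : ℝ) < (b : ℝ) - a := sub_pos.2 (by exact_mod_cast hab)
  rw [funext_iff, funext_iff]
  refine forall_congr' fun j => ?_
  simp only [sLift, vpt, Pi.zero_apply, Int.cast_zero]
  rw [eq_div_iff h.ne']
  constructor <;> intro h' <;> linarith

theorem vpt_mem (hab : a < b) {I : Fin n → ℤ} (hI : IsIndex a b I) : vpt a b I ∈ polytope n := by
  have h : (0 : ℝ) < (b : ℝ) - a := sub_pos.2 (by exact_mod_cast hab)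
  have h2 : (∑ j, (I j : ℝ)) ≤ (b : ℝ) - a := by exact_mod_cast hI.2
  refine ⟨fun j => ?_, ?_⟩
  · have : (0 : ℝ) ≤ I j := by exact_mod_cast hI.1 j
    simp only [vpt]
    positivity
  · simp only [vpt]
    rw [← Finset.sum_div, ← Finset.mul_sum, div_le_iff₀ h]
    linarith

theorem component_eq (hab : a < b) {x : Fin n → ℝ} (hx : x ∈ intersection n a b) :
    connectedComponentIn (intersection n a b) x = {x} := by
  have h : (0 : ℝ) < (b : ℝ) - a := sub_pos.2 (by exact_mod_cast hab)
  refine Subset.antisymm (fun y hy => ?_) (by simpa using mem_connectedComponentIn hx)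
  refine mem_singleton_iff.2 (funext fun j => ?_)
  have hpre : IsPreconnected
      ((fun z : Fin n → ℝ => ((b : ℝ) - a) / 2 * z j) '' connectedComponentIn (intersection n a b) x) :=
    isPreconnected_connectedComponentIn.image _ (by fun_prop)
  have hsub : ((fun z : Fin n → ℝ => ((b : ℝ) - a) / 2 * z j) ''
      connectedComponentIn (intersection n a b) x) ⊆ range ((↑) : ℤ → ℝ) := by
    rintro _ ⟨z, hz, rfl⟩
    obtain ⟨_, I, hI⟩ := mem_intersection.1 (connectedComponentIn_subset _ _ hz)
    refine ⟨I j, ?_⟩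
    have := congrFun hI j
    simp only [sLift, Pi.zero_apply, Int.cast_zero] at this
    linarith
  have hcount : (range ((↑) : ℤ → ℝ)).Countable := countable_range _
  have hss := hcount.isTotallyDisconnected _ hsub hpre
  have := hss (mem_image_of_mem _ hy) (mem_image_of_mem _ (mem_connectedComponentIn hx))
  exact mul_left_cancel₀ (by positivity) this

theorem stableManifold_subset (hab : a < b) (I : Fin n → ℤ) :
    stableManifold (sLift a 0) (sLift b I) (vpt a b I) ⊆ {vpt a b I} := by
  have h : (0 : ℝ) < (b : ℝ) - a := sub_pos.2 (by exact_mod_cast hab)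
  rintro x ⟨γ, rfl, hγ, hlim⟩
  refine mem_singleton_iff.2 (funext fun j => ?_)
  set k : ℝ := ((b : ℝ) - a) / 2 with hk
  have hk0 : 0 < k := by positivity
  have hd : ∀ t ∈ Ici (0 : ℝ), HasDerivWithinAt
      (fun t => Real.exp (-k * t) * (γ t j - vpt a b I j)) 0 (Ici 0) t := by
    intro t ht
    have h1 := (hasDerivWithinAt_pi.1 (hγ t ht) j).sub_const (vpt a b I j)
    have h2 : HasDerivWithinAt (fun t => Real.exp (-k * t)) (Real.exp (-k * t) * (-k * 1)) (Ici 0) t :=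
      (((hasDerivAt_id t).const_mul (-k)).exp).hasDerivWithinAt
    refine (h2.mul h1).congr_deriv ?_
    simp only [negGrad, sLift, vpt, Pi.sub_apply, Pi.zero_apply, Int.cast_zero, hk]
    field_simp
    ring
  have hconst : ∀ T ∈ Ici (0 : ℝ),
      Real.exp (-k * T) * (γ T j - vpt a b I j) = γ 0 j - vpt a b I j := by
    intro T hT
    have := constant_of_has_deriv_right_zero (a := 0) (b := T)
      (f := fun t => Real.exp (-k * t) * (γ t j - vpt a b I j))
      (fun t ht => ((hd t ht.1).continuousWithinAt).mono Icc_subset_Ici_self)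
      (fun t ht => (hd t ht.1).mono (Ici_subset_Ici.2 ht.1)) T ⟨hT, le_rfl⟩
    simpa using this
  have hl1 : Tendsto (fun t => Real.exp (-k * t) * (γ t j - vpt a b I j)) atTop (𝓝 (0 * 0)) := by
    refine Tendsto.mul ?_ ?_
    · refine Real.tendsto_exp_atBot.comp ?_
      exact tendsto_id.const_mul_atTop_of_neg (by linarith)
    · have := (tendsto_pi_nhds.1 hlim j).sub_const (vpt a b I j)
      simpa using this
  have hl2 : Tendsto (fun t => Real.exp (-k * t) * (γ t j - vpt a b I j)) atTop
      (𝓝 (γ 0 j - vpt a b I j)) := by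
    refine tendsto_const_nhds.congr' ?_
    filter_upwards [Ici_mem_atTop (0 : ℝ)] with t ht using (hconst t ht).symm
  have := tendsto_nhds_unique hl2 hl1
  linarith

/-- The generator `V_{ab;I} = {v_{ab;I}}` of `Mo(P)(L_a, L_b)`, `a < b`. -/
def pointGen (hab : a < b) (I : Fin n → ℤ) (hI : IsIndex a b I) : Gen n a b where
  carrier := {vpt a b I}
  label := I
  isComponent := by
    have hx : vpt a b I ∈ intersection n a b :=
      mem_intersection.2 ⟨vpt_mem hab hI, I, (sLift_eq_iff hab).2 rfl⟩
    exact ⟨vpt a b I, hx, (component_eq hab hx).symm⟩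
  graded := fun x hx => (sLift_eq_iff hab).2 hx
  interior := by
    refine ⟨vpt a b I, rfl, nhdsWithin_mono _ (stableManifold_subset hab I) ?_⟩
    rw [nhdsWithin_singleton]
    exact mem_pure.2 (vpt_mem hab hI)

theorem Gen.isIndex (hab : a ≤ b) (V : Gen n a b) : IsIndex a b V.label := by
  have h : (0 : ℝ) ≤ (b : ℝ) - a := sub_nonneg.2 (by exact_mod_cast hab)
  obtain ⟨x, hx⟩ := V.nonempty
  obtain ⟨hP, -⟩ := mem_intersection.1 (V.subset hx)
  have hl : ∀ j, (V.label j : ℝ) = ((b : ℝ) - a) / 2 * x j := by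
    intro j
    have := congrFun (V.graded x hx) j
    simp only [sLift, Pi.zero_apply, Int.cast_zero] at this
    linarith
  refine ⟨fun j => ?_, ?_⟩
  · have : (0 : ℝ) ≤ V.label j := by
      rw [hl j]
      exact mul_nonneg (by positivity) (hP.1 j)
    exact_mod_cast this
  · have : (∑ j, (V.label j : ℝ)) ≤ (b : ℝ) - a := by
      simp only [hl, ← Finset.mul_sum]
      nlinarith [hP.2]
    exact_mod_cast this

/-- For `a < b` every generator is one of the `V_{ab;I}`. -/
theorem Gen.eq_pointGen (hab : a < b) (V : Gen n a b) :
    V = pointGen hab V.label (V.isIndex hab.le) := by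
  refine Gen.ext ?_ rfl
  exact (V.nonempty.subset_singleton_iff).1 fun x hx => (sLift_eq_iff hab).1 (V.graded x hx)

/-! ## The category `𝒱'` in degree zero, and the map `ι` -/

/-- The complement `M̌ = (ℂˣ)ⁿ` of the toric divisors, with the coordinates `w_i = t_i / t_0`. -/
abbrev MCheck (n : ℕ) : Type := Fin n → ℂˣ

/-- A smooth section of `𝒪(k)` on `ℂPⁿ`: a smooth function `F` on `ℂⁿ⁺¹ ∖ 0` which is homogeneous of
degree `k`. (The value of `F` at `0` does not matter.) -/
def IsSmoothSection (n : ℕ) (k : ℤ) (F : (Fin (n + 1) → ℂ) → ℂ) : Prop :=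
  ContDiffOn ℝ ∞ F {0}ᶜ ∧
    ∀ t : Fin (n + 1) → ℂ, t ≠ 0 → ∀ z : ℂ, z ≠ 0 → F (z • t) = z ^ k * F t

/-- `1 + |w_1|² + … + |w_n|²`. -/
def normSum (w : MCheck n) : ℝ := 1 + ∑ i, ‖(w i : ℂ)‖ ^ 2

/-- The twist `Ψ_a = (1 + |w_1|² + … + |w_n|²)^(a/2)`. -/
def twist (a : ℤ) (w : MCheck n) : ℝ := normSum w ^ ((a : ℝ) / 2)

/-- The degree zero part of `𝒱'(𝒪(a), 𝒪(b))`: the functions `Ψ_b⁻¹ ψ̃ Ψ_a` on `M̌`, where `ψ̃` is a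
smooth bundle morphism `𝒪(a) → 𝒪(b)` over `ℂPⁿ`, that is, a smooth section of `𝒪(b - a)`, written in
the trivialization over `t_0 ≠ 0`. -/
def VPrime (n : ℕ) (a b : ℤ) : Submodule ℂ (MCheck n → ℂ) where
  carrier := {ψ | ∃ F, IsSmoothSection n (b - a) F ∧
    ∀ w, ψ w = (twist b w : ℂ)⁻¹ * F (Fin.cons 1 fun i => (w i : ℂ)) * (twist a w : ℂ)}
  add_mem' := by
    rintro ψ ψ' ⟨F, hF, h⟩ ⟨F', hF', h'⟩
    refine ⟨F + F', ⟨hF.1.add hF'.1, fun t ht z hz => ?_⟩, fun w => ?_⟩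
    · simp only [Pi.add_apply, hF.2 t ht z hz, hF'.2 t ht z hz]
      ring
    · simp only [Pi.add_apply, h, h']
      ring
  zero_mem' := ⟨0, ⟨contDiffOn_const, by simp⟩, by simp⟩
  smul_mem' := by
    rintro r ψ ⟨F, hF, h⟩
    refine ⟨fun t => r * F t, ⟨contDiffOn_const.mul hF.1, fun t ht z hz => ?_⟩, fun w => ?_⟩
    · simp only [hF.2 t ht z hz]
      ring
    · simp only [Pi.smul_apply, smul_eq_mul, h]
      ring

theorem normSum_pos (w : MCheck n) : 0 < normSum w := by
  unfold normSum
  positivity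

theorem twist_ne_zero (a : ℤ) (w : MCheck n) : (twist a w : ℂ) ≠ 0 := by
  exact_mod_cast (Real.rpow_pos_of_pos (normSum_pos w) _).ne'

/-- The composition of morphisms of degree zero in `𝒱'`, which is the product of functions. -/
def VPrime.comp (ψ : VPrime n a b) (ψ' : VPrime n b c) : VPrime n a c :=
  ⟨fun w => ψ.1 w * ψ'.1 w, by
    obtain ⟨F, hF, h⟩ := ψ.2
    obtain ⟨F', hF', h'⟩ := ψ'.2
    refine ⟨fun t => F t * F' t, ⟨hF.1.mul hF'.1, fun t ht z hz => ?_⟩, fun w => ?_⟩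
    · have : c - a = (b - a) + (c - b) := by ring
      simp only [hF.2 t ht z hz, hF'.2 t ht z hz, this, zpow_add₀ hz]
      ring
    · have h1 := twist_ne_zero b w
      simp only [h w, h' w]
      field_simp⟩

/-- The dual coordinates `xⁱ = 2 |w_i|² / (1 + ∑ |w_j|²)` of the image in `B` of a point of `M̌`. -/
def toBase (w : MCheck n) : Fin n → ℝ := fun i => 2 * ‖(w i : ℂ)‖ ^ 2 / normSum w

/-- The function `√((2 - x¹ - … - xⁿ)/2)^(b - a - |I|) ∏ √(xʲ/2)^(i_j)` on `P`. -/
def modulus (a b : ℤ) (I : Fin n → ℤ) (x : Fin n → ℝ) : ℝ :=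
  √((2 - ∑ j, x j) / 2) ^ (b - a - ∑ j, I j) * ∏ j, √(x j / 2) ^ I j

/-- The normalization constant `c_{ab;I}`, which makes the maximum over `P` equal to `1`. -/
def normConst (a b : ℤ) (I : Fin n → ℤ) : ℝ := (sSup (modulus a b I '' polytope n))⁻¹

/-- The function `𝐞_{ab;I}` on `M̌`:
`c_{ab;I} √((2 - x¹ - … - xⁿ)/2)^(b - a - |I|) ∏ (√(xʲ/2) exp(𝐢 y_j))^(i_j)`, where
`w_j = |w_j| exp(𝐢 y_j)`. -/
def eFun (a b : ℤ) (I : Fin n → ℤ) (w : MCheck n) : ℂ :=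
  (normConst a b I : ℂ) * (√((2 - ∑ j, toBase w j) / 2) : ℂ) ^ (b - a - ∑ j, I j) *
    ∏ j, ((√(toBase w j / 2) : ℂ) * ((w j : ℂ) / (‖(w j : ℂ)‖ : ℂ))) ^ I j

theorem eFun_mem {I : Fin n → ℤ} (hI : IsIndex a b I) : eFun a b I ∈ VPrime n a b := by
  obtain ⟨N, hN⟩ : ∃ N : Fin n → ℕ, ∀ j, I j = N j :=
    ⟨fun j => (I j).toNat, fun j => (Int.toNat_of_nonneg (hI.1 j)).symm⟩
  obtain ⟨m, hm⟩ : ∃ m : ℕ, b - a - ∑ j, I j = m :=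
    ⟨(b - a - ∑ j, I j).toNat, (Int.toNat_of_nonneg (by linarith [hI.2])).symm⟩
  have hba : b - a = m + ∑ j, (N j : ℤ) := by
    rw [← hm]
    simp only [hN]
    ring
  refine ⟨fun t => normConst a b I * t 0 ^ m * ∏ j : Fin n, t j.succ ^ N j,
    ⟨ContDiff.contDiffOn ?_, fun t _ z hz => ?_⟩, fun w => ?_⟩
  · refine (contDiff_const.mul ((contDiff_apply ℝ ℂ 0).pow m)).mul ?_
    exact contDiff_prod fun j _ => (contDiff_apply ℝ ℂ j.succ).pow (N j)
  · simp only [Pi.smul_apply, smul_eq_mul, mul_pow, Finset.prod_mul_distrib,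
      Finset.prod_pow_eq_pow_sum, hba]
    have : z ^ ((m : ℤ) + ∑ j, (N j : ℤ)) = z ^ m * z ^ ∑ j, N j := by
      rw [← pow_add, ← zpow_natCast]
      push_cast
      rfl
    rw [this]
    ring
  · have hS := normSum_pos w
    set r : ℝ := √(normSum w) with hr
    have hr0 : 0 < r := Real.sqrt_pos.2 hS
    have hrC : (r : ℂ) ≠ 0 := by exact_mod_cast hr0.ne'
    have htw : ∀ d : ℤ, (twist d w : ℂ) = (r : ℂ) ^ d := by
      intro d
      have : twist d w = r ^ d := by
        rw [twist, hr, Real.sqrt_eq_rpow, ← Real.rpow_intCast, ← Real.rpow_mul hS.le]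
        congr 1
        ring
      rw [this]
      push_cast
      rfl
    have h0 : √((2 - ∑ j, toBase w j) / 2) = r⁻¹ := by
      rw [hr, ← Real.sqrt_inv]
      congr 1
      simp only [toBase]
      rw [← Finset.sum_div, ← Finset.mul_sum]
      have : ∑ j, ‖(w j : ℂ)‖ ^ 2 = normSum w - 1 := by
        unfold normSum
        ring
      rw [this]
      field_simp
      ring
    have hj : ∀ j, (√(toBase w j / 2) : ℂ) * ((w j : ℂ) / (‖(w j : ℂ)‖ : ℂ)) = (r : ℂ)⁻¹ * w j := by
      intro j
      have h1 : √(toBase w j / 2) = r⁻¹ * ‖(w j : ℂ)‖ := by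
        have : toBase w j / 2 = ‖(w j : ℂ)‖ ^ 2 / normSum w := by
          simp only [toBase]
          ring
        rw [this, Real.sqrt_div' _ hS.le, Real.sqrt_sq (norm_nonneg _)]
        ring
      have h2 : (‖(w j : ℂ)‖ : ℂ) ≠ 0 := by simp
      rw [h1]
      push_cast
      field_simp
    have hab : (r : ℂ) ^ b = (r : ℂ) ^ a * ((r : ℂ) ^ m * (r : ℂ) ^ ∑ j, N j) := by
      have : b = a + (m + ∑ j, (N j : ℤ)) := by linarith
      rw [this, zpow_add₀ hrC, ← pow_add, ← zpow_natCast (r : ℂ) (m + ∑ j, N j)]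
      push_cast
      rfl
    have hra : (r : ℂ) ^ a ≠ 0 := zpow_ne_zero _ hrC
    simp only [eFun, hm]
    simp only [h0, hj, htw, hab, hN, zpow_natCast, mul_pow, Finset.prod_mul_distrib,
      Finset.prod_pow_eq_pow_sum, Fin.cons_zero, Fin.cons_succ, Complex.ofReal_inv]
    rw [inv_pow, inv_pow]
    have h3 : (r : ℂ) ^ m ≠ 0 := pow_ne_zero _ hrC
    have h4 : (r : ℂ) ^ ∑ j, N j ≠ 0 := pow_ne_zero _ hrC
    field_simp
    simp only [one_pow, mul_one]

/-- `𝐞_{ab;I}` as a morphism of degree zero in `𝒱'`. -/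
def eHom (I : Fin n → ℤ) (hI : IsIndex a b I) : VPrime n a b := ⟨eFun a b I, eFun_mem hI⟩

/-- The linear map `ι : Mo(P)(L_a, L_b) → 𝒱'(𝒪(a), 𝒪(b))`, `a ≤ b`, which sends the generator with
label `I` to `𝐞_{ab;I}`. -/
def iota (hab : a ≤ b) : Mo n a b →ₗ[ℂ] VPrime n a b :=
  Finsupp.linearCombination ℂ fun V => eHom V.label (V.isIndex hab)

end

end MorseCPn

open MorseCPn

/-! For lifts of `L_b` and `L_c` with `b < c`, the vector field is `k (x - v)` with `k = (c - b)/2 >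
0`, where `v` is the intersection point labelled by the difference of the lifts (`negGrad_sLift`).
So `v` is a source and all trajectories are `v + exp(k t) (m - v)` (`eqOn_expCurve`). Backwards in
time everything flows to `v`, so the leaf points determine the lifts: they are shifted by `I` and `I
+ J`. Forwards in time only the constant trajectory converges, so the root edge stays at
`v_{ac;I+J}`. The vertex, and with it the leaf edges, are then forced. The tree exists because
`v_{ac;I+J}` is the barycentre of the leaf points with masses `b - a` and `c - b`, and `P` is
convex.

For the weight, the area of a strip is the energy `∫ g(γ', γ') dt`. In the homogeneous coordinates
`y_i` of `γ`, whose sum is constant, the integrand is the derivative of `-(k/2) ∑ v_i log y_i`. As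
`k v_i` is the homogeneous label, an edge from `v` to `m` has area `1/2 ∑ K_i (log v_i - log m_i)`
(`lintegral_hessianMetric_expCurve`, `leafArea_eq`).

On the other side, `𝐞_{ab;I}` is a monomial times a constant, and the monomials multiply exactly.
The modulus of the monomial is maximal at `v_{ab;I}` (`isGreatest_modulus`), so the constants are
explicit exponentials in `log v_i`. Their quotient is `exp(-A)` with the same `A` (`normConst_mul`).
-/

namespace MorseCPn

noncomputable section

variable {n : ℕ} {a b c : ℤ}

/-! ## Homogeneous coordinates -/

/-- The homogeneous coordinates `(d - ∑ xʲ, x¹, …, xⁿ)`, whose sum is `d`. -/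
def homog {R : Type*} [AddCommGroup R] (d : R) (x : Fin n → R) : Fin (n + 1) → R :=
  Fin.cons (d - ∑ j, x j) x

theorem sum_homog {R : Type*} [AddCommGroup R] (d : R) (x : Fin n → R) :
    ∑ i, homog d x i = d := by
  simp [Fin.sum_univ_succ, homog]

theorem homog_add {R : Type*} [AddCommGroup R] (d e : R) (x y : Fin n → R) (i : Fin (n + 1)) :
    homog (d + e) (x + y) i = homog d x i + homog e y i := by
  refine Fin.cases ?_ (fun j => ?_) i
  · simp only [homog, Fin.cons_zero, Pi.add_apply, Finset.sum_add_distrib]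
    abel
  · simp [homog]

theorem homog_smul (r d : ℝ) (x : Fin n → ℝ) (i : Fin (n + 1)) :
    homog (r * d) (r • x) i = r * homog d x i := by
  refine Fin.cases ?_ (fun j => ?_) i
  · simp [homog, mul_sub, Finset.mul_sum]
  · simp [homog]

theorem homog_zero_sub (d : ℝ) (x y : Fin n → ℝ) (i : Fin (n + 1)) :
    homog 0 (x - y) i = homog d x i - homog d y i := by
  have h := homog_add 0 d (x - y) y i
  rw [zero_add, sub_add_cancel] at h
  linarith

theorem homog_nonneg {x : Fin n → ℝ} (hx : x ∈ polytope n) (i : Fin (n + 1)) :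
    0 ≤ homog 2 x i := by
  refine Fin.cases ?_ (fun j => ?_) i
  · simpa [homog] using hx.2
  · simpa [homog] using hx.1 j

theorem IsIndex.homog_nonneg {I : Fin n → ℤ} (hI : IsIndex a b I) (i : Fin (n + 1)) :
    0 ≤ homog (b - a) I i := by
  refine Fin.cases ?_ (fun j => ?_) i
  · simpa [homog] using hI.2
  · simpa [homog] using hI.1 j

theorem homog_vpt (hab : a < b) (I : Fin n → ℤ) (i : Fin (n + 1)) :
    homog 2 (vpt a b I) i = 2 * (homog (b - a) I i : ℤ) / ((b : ℝ) - a) := by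
  have h : (0 : ℝ) < (b : ℝ) - a := sub_pos.2 (by exact_mod_cast hab)
  refine Fin.cases ?_ (fun j => ?_) i
  · simp only [homog, vpt, Fin.cons_zero, ← Finset.sum_div, ← Finset.mul_sum]
    push_cast
    field_simp
  · simp [homog, vpt]

/-- Puts all `n + 1` facets on an equal footing. On a face, tangent vectors give terms `0 / 0 = 0`,
so the formula needs no case distinction. -/
theorem hessianMetric_eq (x ξ ζ : Fin n → ℝ) :
    hessianMetric x ξ ζ = 1 / 2 * ∑ i, homog 0 ξ i * homog 0 ζ i / homog 2 x i := by
  simp only [hessianMetric, Fin.sum_univ_succ, homog, Fin.cons_zero, Fin.cons_succ]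
  ring

theorem convex_polytope (n : ℕ) : Convex ℝ (polytope n) := by
  intro x hx y hy r s hr hs hrs
  refine ⟨fun i => ?_, ?_⟩
  · have := hx.1 i
    have := hy.1 i
    simp only [Pi.add_apply, Pi.smul_apply, smul_eq_mul]
    positivity
  · simp only [Pi.add_apply, Pi.smul_apply, smul_eq_mul, Finset.sum_add_distrib, ← Finset.mul_sum]
    nlinarith [hx.2, hy.2]

/-! ## Trajectories -/

/-- The solution of `γ' = k (γ - v)` with `γ 0 = m`. -/
def expCurve (k : ℝ) (v m : Fin n → ℝ) (t : ℝ) : Fin n → ℝ := v + Real.exp (k * t) • (m - v)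

theorem expCurve_zero (k : ℝ) (v m : Fin n → ℝ) : expCurve k v m 0 = m := by
  simp [expCurve]

theorem hasDerivAt_expCurve (k : ℝ) (v m : Fin n → ℝ) (t : ℝ) :
    HasDerivAt (expCurve k v m) (k • (expCurve k v m t - v)) t := by
  have h : HasDerivAt (fun t => Real.exp (k * t)) (Real.exp (k * t) * (k * 1)) t :=
    ((hasDerivAt_id t).const_mul k).exp
  refine ((h.smul_const (m - v)).const_add v).congr_deriv ?_
  rw [expCurve, add_sub_cancel_left, smul_smul, mul_one, mul_comm]

theorem tendsto_expCurve_atBot {k : ℝ} (hk : 0 < k) (v m : Fin n → ℝ) :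
    Tendsto (expCurve k v m) atBot (𝓝 v) := by
  have h : Tendsto (fun t => Real.exp (k * t)) atBot (𝓝 0) :=
    Real.tendsto_exp_atBot.comp (tendsto_id.const_mul_atBot hk)
  have h2 := (h.smul_const (m - v)).const_add v
  rw [zero_smul, add_zero] at h2
  exact h2

theorem expCurve_mem_polytope {k t : ℝ} (hk : 0 < k) (ht : t ≤ 0) {v m : Fin n → ℝ}
    (hv : v ∈ polytope n) (hm : m ∈ polytope n) : expCurve k v m t ∈ polytope n :=
  (convex_polytope n).add_smul_sub_mem hv hm
    ⟨(Real.exp_pos _).le, Real.exp_le_one_iff.2 (mul_nonpos_of_nonneg_of_nonpos hk.le ht)⟩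

theorem insert_image_expCurve {k : ℝ} (hk : 0 < k) (v m : Fin n → ℝ) :
    insert v (expCurve k v m '' Iic 0) = segment ℝ v m := by
  rw [segment_eq_image']
  ext x
  constructor
  · rintro (rfl | ⟨t, ht, rfl⟩)
    · exact ⟨0, by simp, by simp⟩
    · exact ⟨Real.exp (k * t), ⟨(Real.exp_pos _).le,
        Real.exp_le_one_iff.2 (mul_nonpos_of_nonneg_of_nonpos hk.le ht)⟩, rfl⟩
  · rintro ⟨r, ⟨h0, h1⟩, rfl⟩
    rcases h0.eq_or_lt with rfl | h0
    · simp
    -- The factor `exp(k t)` takes each value in `(0, 1]` on `(-∞, 0]`; the missing value `0` is the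
    -- starting point `v`.
    · refine Or.inr ⟨Real.log r / k, div_nonpos_of_nonpos_of_nonneg
        (Real.log_nonpos h0.le h1) hk.le, ?_⟩
      rw [expCurve, mul_div_cancel₀ _ hk.ne', Real.exp_log h0]

/-- The integrating factor `exp(-k t)` turns the equation into a vanishing derivative of `exp(-k t)
(γ - v)`, which is therefore constant on the convex set `D`. -/
theorem eqOn_expCurve {k : ℝ} {v : Fin n → ℝ} {D : Set ℝ} (hD : Convex ℝ D) (h0 : (0 : ℝ) ∈ D)
    {γ : ℝ → Fin n → ℝ} (hγ : ∀ t ∈ D, HasDerivWithinAt γ (k • (γ t - v)) D t) :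
    EqOn γ (expCurve k v (γ 0)) D := by
  intro t ht
  have hd : ∀ t ∈ D, HasDerivWithinAt (fun t => Real.exp (-k * t) • (γ t - v)) 0 D t := by
    intro t ht
    have h2 : HasDerivWithinAt (fun t => Real.exp (-k * t)) (Real.exp (-k * t) * (-k * 1)) D t :=
      (((hasDerivAt_id t).const_mul (-k)).exp).hasDerivWithinAt
    refine (h2.smul ((hγ t ht).sub_const v)).congr_deriv ?_
    rw [smul_smul, ← add_smul]
    ring_nf
    simp
  have h := hD.norm_image_sub_le_of_norm_hasDerivWithin_le hd (C := 0) (by simp) h0 ht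
  rw [zero_mul, norm_le_zero_iff, sub_eq_zero] at h
  simp only [mul_zero, Real.exp_zero, one_smul] at h
  rw [expCurve, ← h, smul_smul, ← Real.exp_add]
  simp

/-- The rate `(c - b)/2` is positive, so the zero of the field is a source; uniqueness of the tree
rests on this. -/
theorem negGrad_sLift (hbc : b < c) (p q : Fin n → ℤ) (x : Fin n → ℝ) :
    negGrad (sLift b p) (sLift c q) x = (((c : ℝ) - b) / 2) • (x - vpt b c (q - p)) := by
  have h : (0 : ℝ) < (c : ℝ) - b := sub_pos.2 (by exact_mod_cast hbc)
  ext j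
  simp only [negGrad, sLift, vpt, Pi.sub_apply, Pi.smul_apply, smul_eq_mul]
  push_cast
  field_simp
  ring

theorem vpt_injective (hab : a < b) : Function.Injective (vpt (n := n) a b) := by
  have h : (0 : ℝ) < (b : ℝ) - a := sub_pos.2 (by exact_mod_cast hab)
  intro I J hIJ
  ext j
  have := congrFun hIJ j
  simp only [vpt] at this
  have h2 : (I j : ℝ) = J j := by
    field_simp at this
    exact this
  exact_mod_cast h2

theorem isTrajectory_expCurve (hbc : b < c) {p q K : Fin n → ℤ} (hK : q - p = K)
    {m : Fin n → ℝ} (hKi : IsIndex b c K) (hm : m ∈ polytope n) :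
    IsTrajectory (negGrad (sLift b p) (sLift c q)) (Iic 0)
      (expCurve (((c : ℝ) - b) / 2) (vpt b c K) m) := by
  have h : (0 : ℝ) < (c : ℝ) - b := sub_pos.2 (by exact_mod_cast hbc)
  intro t ht
  refine ⟨expCurve_mem_polytope (by positivity) ht (vpt_mem hbc hKi) hm, ?_⟩
  rw [negGrad_sLift hbc, hK]
  exact (hasDerivAt_expCurve _ _ _ t).hasDerivWithinAt

theorem IsTrajectory.eqOn_expCurve (hbc : b < c) {p q : Fin n → ℤ} {γ : ℝ → Fin n → ℝ}
    {D : Set ℝ} (hD : Convex ℝ D) (h0 : (0 : ℝ) ∈ D)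
    (hγ : IsTrajectory (negGrad (sLift b p) (sLift c q)) D γ) :
    EqOn γ (expCurve (((c : ℝ) - b) / 2) (vpt b c (q - p)) (γ 0)) D :=
  MorseCPn.eqOn_expCurve hD h0 fun t ht => negGrad_sLift hbc p q (γ t) ▸ (hγ t ht).2

/-- The starting point of a trajectory over `(-∞, 0]` determines the lifts. -/
theorem IsTrajectory.shift_eq (hbc : b < c) {p q K : Fin n → ℤ} {γ : ℝ → Fin n → ℝ}
    (hγ : IsTrajectory (negGrad (sLift b p) (sLift c q)) (Iic 0) γ)
    (hlim : Tendsto γ atBot (𝓝 (vpt b c K))) : q - p = K := by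
  have h : (0 : ℝ) < (c : ℝ) - b := sub_pos.2 (by exact_mod_cast hbc)
  have h1 := (tendsto_expCurve_atBot (half_pos h) (vpt b c (q - p)) (γ 0)).congr'
    (f₂ := γ) (by
      filter_upwards [Iic_mem_atBot (0 : ℝ)] with t ht
      exact (hγ.eqOn_expCurve hbc (convex_Iic 0) self_mem_Iic ht).symm)
  exact vpt_injective hbc (tendsto_nhds_unique h1 hlim)

/-- A convergent trajectory over `[0, ∞)` is constant. -/
theorem IsTrajectory.eq_vpt (hbc : b < c) {p q : Fin n → ℤ} {γ : ℝ → Fin n → ℝ} {x : Fin n → ℝ}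
    (hγ : IsTrajectory (negGrad (sLift b p) (sLift c q)) (Ici 0) γ)
    (hlim : Tendsto γ atTop (𝓝 x)) : ∀ t, 0 ≤ t → γ t = vpt b c (q - p) := by
  have h : (0 : ℝ) < (c : ℝ) - b := sub_pos.2 (by exact_mod_cast hbc)
  set k : ℝ := ((c : ℝ) - b) / 2
  set v := vpt b c (q - p)
  have hk : 0 < k := half_pos h
  have he : EqOn γ (expCurve k v (γ 0)) (Ici 0) :=
    hγ.eqOn_expCurve hbc (convex_Ici 0) self_mem_Ici
  have hl : Tendsto (fun t => Real.exp (-k * t) • (γ t - v)) atTop (𝓝 ((0 : ℝ) • (x - v))) := by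
    refine Tendsto.smul ?_ (hlim.sub_const v)
    exact Real.tendsto_exp_atBot.comp (tendsto_id.const_mul_atTop_of_neg (by linarith))
  -- `exp(-k t) (γ t - v)` is constant in `t`, but tends to `0` because `γ` converges.
  have h0 : γ 0 - v = (0 : ℝ) • (x - v) := by
    refine tendsto_nhds_unique (tendsto_const_nhds.congr' ?_) hl
    filter_upwards [Ici_mem_atTop (0 : ℝ)] with t ht
    rw [he ht, expCurve, add_sub_cancel_left, smul_smul, ← Real.exp_add]
    simp
  rw [zero_smul] at h0
  intro t ht
  rw [he ht, expCurve, h0, smul_zero, add_zero]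

/-! ## Symplectic areas -/

/-- The area of the strip over a trajectory is the energy of the trajectory. -/
theorem stripArea_eq {p q : Fin n → ℤ} {γ : ℝ → Fin n → ℝ} {D : Set ℝ} (hD : Convex ℝ D)
    (hDm : MeasurableSet D) (hγ : IsTrajectory (negGrad (sLift b p) (sLift c q)) D γ) :
    stripArea (sLift b p) (sLift c q) γ D = ∫⁻ t in D, ENNReal.ofReal (hessianMetric (γ t)
      (negGrad (sLift b p) (sLift c q) (γ t)) (negGrad (sLift b p) (sLift c q) (γ t))) := by
  -- The two-sided derivative in the definition of the area is only available inside `D`; the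
  -- frontier of a convex set is null.
  have hae : ∀ᵐ t ∂MeasureTheory.volume, t ∉ frontier D :=
    MeasureTheory.measure_eq_zero_iff_ae_notMem.1 (hD.addHaar_frontier _)
  refine MeasureTheory.setLIntegral_congr_fun_ae hDm ?_
  filter_upwards [hae] with t ht htD
  have hDt : D ∈ 𝓝 t := by
    rw [← mem_interior_iff_mem_nhds]
    by_contra h
    exact ht ⟨subset_closure htD, h⟩
  have hd := ((hγ t htD).2).hasDerivAt hDt
  set X := negGrad (sLift b p) (sLift c q) (γ t) with hX
  have h1 : ∀ u, (deriv (fun τ => strip (sLift b p) (sLift c q) γ τ u) t).1 = X := by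
    intro u
    -- The fibre component must be differentiable too, since otherwise the derivative of the pair
    -- would be the default `0`.
    have hg : DifferentiableAt ℝ (fun τ => (strip (sLift b p) (sLift c q) γ τ u).2) t := by
      have hdj := fun j => (hasDerivAt_pi.1 hd j).differentiableAt
      refine differentiableAt_pi.2 fun j => ?_
      simp only [strip, sLift, Pi.add_apply, Pi.smul_apply, smul_eq_mul]
      have := hdj j
      fun_prop
    exact congrArg Prod.fst (hd.prodMk hg.hasDerivAt).deriv
  have h2 : ∀ u, deriv (strip (sLift b p) (sLift c q) γ t) u = (0, X) := by
    intro u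
    have h3 : HasDerivAt (fun u : ℝ => (1 - u) • sLift b p (γ t) + u • sLift c q (γ t)) X u := by
      refine ((((hasDerivAt_id u).const_sub 1).smul_const _).add
        ((hasDerivAt_id u).smul_const _)).congr_deriv ?_
      rw [hX, negGrad, neg_one_smul, one_smul]
      abel
    exact ((hasDerivAt_const u (γ t)).prodMk h3).deriv
  -- `∂_u` has no `x`-part, so the fibre part of `∂_t` does not matter, and only `g(X, X)` survives.
  simp [h1, h2, symplecticForm, hessianMetric]

/-- The area of the strip over the trajectory from `v_{bc;K}` to `m`. -/
def leafArea (b c : ℤ) (K : Fin n → ℤ) (m : Fin n → ℝ) : ℝ :=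
  1 / 2 * ∑ i, ((homog (c - b) K i : ℤ) : ℝ) * (Real.log (homog 2 (vpt b c K) i) - Real.log (homog 2 m i))

theorem hessianMetric_self_nonneg {x : Fin n → ℝ} (hx : x ∈ polytope n) (ξ : Fin n → ℝ) :
    0 ≤ hessianMetric x ξ ξ := by
  rw [hessianMetric_eq]
  exact mul_nonneg (by norm_num) (Finset.sum_nonneg fun i _ =>
    div_nonneg (mul_self_nonneg _) (homog_nonneg hx i))

theorem homog_expCurve (k : ℝ) (v m : Fin n → ℝ) (t : ℝ) (i : Fin (n + 1)) :
    homog 2 (expCurve k v m t) i =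
      homog 2 v i + Real.exp (k * t) * (homog 2 m i - homog 2 v i) := by
  have h := homog_smul (Real.exp (k * t)) 0 (m - v) i
  rw [mul_zero] at h
  rw [expCurve, ← add_zero (2 : ℝ), homog_add, h, add_zero, homog_zero_sub 2]

/-- The energy of the trajectory from `v` to `m`. -/
theorem lintegral_hessianMetric_expCurve {k : ℝ} (hk : 0 < k) {v m : Fin n → ℝ}
    (hv : v ∈ polytope n) (hm : m ∈ polytope n)
    (hvm : ∀ i, homog 2 m i = 0 → homog 2 v i = 0) :
    0 ≤ k / 2 * ∑ i, homog 2 v i * (Real.log (homog 2 v i) - Real.log (homog 2 m i)) ∧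
    ∫⁻ t in Iic 0, ENNReal.ofReal (hessianMetric (expCurve k v m t)
      (k • (expCurve k v m t - v)) (k • (expCurve k v m t - v))) =
    ENNReal.ofReal
      (k / 2 * ∑ i, homog 2 v i * (Real.log (homog 2 v i) - Real.log (homog 2 m i))) := by
  set f : ℝ → ℝ := fun t => hessianMetric (expCurve k v m t)
      (k • (expCurve k v m t - v)) (k • (expCurve k v m t - v)) with hf
  -- A primitive of the energy density: with `y' = k (y - v)` one has `(y')² / y = k y' - k v y' /
  -- y`, and the terms `k y'` sum to zero.
  set F : ℝ → ℝ := fun t =>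
    -(k / 2) * ∑ i, homog 2 v i * Real.log (homog 2 (expCurve k v m t) i) with hF
  have hfn : ∀ t ≤ 0, 0 ≤ f t := fun t ht =>
    hessianMetric_self_nonneg (expCurve_mem_polytope hk ht hv hm) _
  -- The coordinate is `(1 - e) v_i + e m_i` with `0 < e ≤ 1`. Where `m_i = 0`, also `v_i = 0`, and
  -- the corresponding terms vanish identically.
  have hpos : ∀ t ≤ 0, ∀ i, homog 2 m i ≠ 0 → 0 < homog 2 (expCurve k v m t) i := by
    intro t ht i hi
    have h1 := homog_nonneg hv i
    have h2 := (homog_nonneg hm i).lt_of_ne' hi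
    have h3 : Real.exp (k * t) ≤ 1 :=
      Real.exp_le_one_iff.2 (mul_nonpos_of_nonneg_of_nonpos hk.le ht)
    have h4 := Real.exp_pos (k * t)
    rw [homog_expCurve]
    nlinarith [mul_pos h4 h2, mul_nonneg (sub_nonneg.2 h3) h1]
  have hderiv : ∀ t ≤ 0, HasDerivAt F (f t) t := by
    intro t ht
    set e := Real.exp (k * t) with he
    have hy : ∀ i, HasDerivAt (fun t => homog 2 (expCurve k v m t) i)
        (k * e * (homog 2 m i - homog 2 v i)) t := by
      intro i
      simp only [homog_expCurve]
      have h : HasDerivAt (fun t => Real.exp (k * t)) (Real.exp (k * t) * (k * 1)) t :=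
        ((hasDerivAt_id t).const_mul k).exp
      refine ((h.mul_const _).const_add _).congr_deriv ?_
      rw [← he]
      ring
    have hl : ∀ i, HasDerivAt (fun t => homog 2 v i * Real.log (homog 2 (expCurve k v m t) i))
        (homog 2 v i * (k * e * (homog 2 m i - homog 2 v i) / homog 2 (expCurve k v m t) i)) t := by
      intro i
      by_cases hi : homog 2 m i = 0
      · simpa [hvm i hi] using hasDerivAt_const t (0 : ℝ)
      · exact ((hy i).log (hpos t ht i hi).ne').const_mul _
    refine ((HasDerivAt.fun_sum fun i _ => hl i).const_mul (-(k / 2))).congr_deriv ?_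
    simp only [hf, hessianMetric_eq]
    have h0 : ∑ i, (homog 2 m i - homog 2 v i) = 0 := by
      rw [Finset.sum_sub_distrib, sum_homog, sum_homog, sub_self]
    have hx : ∀ i, homog 0 (k • (expCurve k v m t - v)) i = k * e * (homog 2 m i - homog 2 v i) := by
      intro i
      have h := homog_smul k 0 (expCurve k v m t - v) i
      rw [mul_zero] at h
      rw [h, homog_zero_sub 2, homog_expCurve]
      ring
    have hterm : ∀ i, homog 0 (k • (expCurve k v m t - v)) i *
        homog 0 (k • (expCurve k v m t - v)) i / homog 2 (expCurve k v m t) i =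
        k * (k * e * (homog 2 m i - homog 2 v i)) - k * (homog 2 v i *
          (k * e * (homog 2 m i - homog 2 v i) / homog 2 (expCurve k v m t) i)) := by
      intro i
      rw [hx]
      by_cases hi : homog 2 m i = 0
      · simp [hvm i hi, hi]
      · have h1 := (hpos t ht i hi).ne'
        field_simp
        rw [homog_expCurve]
        ring
    rw [Finset.sum_congr rfl fun i _ => hterm i, Finset.sum_sub_distrib, ← Finset.mul_sum,
      ← Finset.mul_sum, ← Finset.mul_sum, h0]
    ring
  have hlim : Tendsto F atBot (𝓝 (-(k / 2) * ∑ i, homog 2 v i * Real.log (homog 2 v i))) := by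
    refine (tendsto_finsetSum _ fun i _ => ?_).const_mul _
    -- A coordinate with `v_i = 0` may tend to `0`, but its logarithm carries the coefficient `v_i`.
    by_cases hi : homog 2 v i = 0
    · simp [hi]
    · refine Tendsto.const_mul _ (Tendsto.log ?_ hi)
      simp only [homog_expCurve]
      have h : Tendsto (fun t => Real.exp (k * t)) atBot (𝓝 0) :=
        Real.tendsto_exp_atBot.comp (tendsto_id.const_mul_atBot hk)
      simpa using (h.mul_const (homog 2 m i - homog 2 v i)).const_add (homog 2 v i)
  have hint : MeasureTheory.IntegrableOn f (Iic 0) := by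
    -- A nonnegative derivative is integrable once its primitive has a limit; the criterion is for
    -- `(0, ∞)`, hence the reflection `t ↦ -t`.
    have h1 : MeasureTheory.IntegrableOn (fun t => f (-t)) (Ioi 0) := by
      refine MeasureTheory.integrableOn_Ioi_deriv_of_nonneg' (g := fun t => -F (-t)) (l :=
        -(-(k / 2) * ∑ i, homog 2 v i * Real.log (homog 2 v i))) (fun t ht => ?_)
        (fun t ht => hfn _ (by simpa using (mem_Ioi.1 ht).le)) ?_
      · have := ((hderiv (-t) (by simpa using ht)).scomp t (hasDerivAt_neg t)).fun_neg
        simpa [Function.comp_def] using this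
      · exact (hlim.comp tendsto_neg_atTop_atBot).neg
    have h2 := (integrableOn_Ici_iff_integrableOn_Ioi).2 h1
    simpa using h2.comp_neg
  have hval := MeasureTheory.integral_Iic_of_hasDerivAt_of_tendsto' (fun t ht => hderiv t ht)
    hint hlim
  have hval' : k / 2 * ∑ i, homog 2 v i * (Real.log (homog 2 v i) - Real.log (homog 2 m i)) =
      ∫ t in Iic 0, f t := by
    rw [hval]
    simp only [hF, expCurve_zero, mul_sub, Finset.sum_sub_distrib]
    ring
  rw [hval']
  have hae : 0 ≤ᵐ[MeasureTheory.volume.restrict (Iic 0)] f :=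
    (MeasureTheory.ae_restrict_iff' measurableSet_Iic).2 (MeasureTheory.ae_of_all _ fun t ht => hfn t ht)
  exact ⟨MeasureTheory.integral_nonneg_of_ae hae,
    (MeasureTheory.ofReal_integral_eq_lintegral_ofReal hint hae).symm⟩

theorem leafArea_eq (hbc : b < c) (K : Fin n → ℤ) (m : Fin n → ℝ) :
    leafArea b c K m = ((c : ℝ) - b) / 2 / 2 * ∑ i, homog 2 (vpt b c K) i *
      (Real.log (homog 2 (vpt b c K) i) - Real.log (homog 2 m i)) := by
  have h : (0 : ℝ) < (c : ℝ) - b := sub_pos.2 (by exact_mod_cast hbc)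
  rw [leafArea, Finset.mul_sum, Finset.mul_sum]
  refine Finset.sum_congr rfl fun i _ => ?_
  have h1 : ((homog (c - b) K i : ℤ) : ℝ) = ((c : ℝ) - b) / 2 * homog 2 (vpt b c K) i := by
    rw [homog_vpt hbc]
    field_simp
  rw [h1]
  ring

theorem stripArea_leaf (hbc : b < c) {p q K : Fin n → ℤ} (hK : IsIndex b c K)
    {γ : ℝ → Fin n → ℝ} (hγ : IsTrajectory (negGrad (sLift b p) (sLift c q)) (Iic 0) γ)
    (hlim : Tendsto γ atBot (𝓝 (vpt b c K)))
    (h0 : ∀ i, homog 2 (γ 0) i = 0 → homog 2 (vpt b c K) i = 0) :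
    0 ≤ leafArea b c K (γ 0) ∧
    stripArea (sLift b p) (sLift c q) γ (Iic 0) = ENNReal.ofReal (leafArea b c K (γ 0)) := by
  have h : (0 : ℝ) < (c : ℝ) - b := sub_pos.2 (by exact_mod_cast hbc)
  have hpq := hγ.shift_eq hbc hlim
  have key := lintegral_hessianMetric_expCurve (half_pos h) (vpt_mem hbc hK)
    (hγ 0 self_mem_Iic).1 h0
  rw [leafArea_eq hbc]
  refine ⟨key.1, ?_⟩
  rw [stripArea_eq (convex_Iic 0) measurableSet_Iic hγ, ← key.2]
  refine MeasureTheory.setLIntegral_congr_fun measurableSet_Iic fun t ht => ?_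
  have h1 := hγ.eqOn_expCurve hbc (convex_Iic 0) self_mem_Iic ht
  rw [hpq] at h1
  simp only [negGrad_sLift hbc, hpq, h1]

theorem stripArea_root (hbc : b < c) {p q : Fin n → ℤ} {γ : ℝ → Fin n → ℝ} {x : Fin n → ℝ}
    (hγ : IsTrajectory (negGrad (sLift b p) (sLift c q)) (Ici 0) γ)
    (hlim : Tendsto γ atTop (𝓝 x)) :
    stripArea (sLift b p) (sLift c q) γ (Ici 0) = 0 := by
  rw [stripArea_eq (convex_Ici 0) measurableSet_Ici hγ,
    MeasureTheory.setLIntegral_congr_fun (g := fun _ => 0) measurableSet_Ici fun t ht => ?_]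
  · simp
  · simp [negGrad_sLift hbc, hγ.eq_vpt hbc hlim t ht, hessianMetric]

/-! ## The gradient tree -/

/-- Each point times its degree is twice its homogeneous label, and labels and degrees add. -/
theorem sub_mul_vpt_add (hab : a < b) (hbc : b < c) (I J : Fin n → ℤ) (i : Fin (n + 1)) :
    ((c : ℝ) - a) * homog 2 (vpt a c (I + J)) i =
      ((b : ℝ) - a) * homog 2 (vpt a b I) i + ((c : ℝ) - b) * homog 2 (vpt b c J) i := by
  have h1 : (0 : ℝ) < (b : ℝ) - a := sub_pos.2 (by exact_mod_cast hab)
  have h2 : (0 : ℝ) < (c : ℝ) - b := sub_pos.2 (by exact_mod_cast hbc)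
  have h3 : (0 : ℝ) < (c : ℝ) - a := by linarith
  have h4 : c - a = (b - a) + (c - b) := by ring
  rw [homog_vpt hab, homog_vpt hbc, homog_vpt (hab.trans hbc), h4, homog_add]
  push_cast
  field_simp

theorem vpt_add_mem_segment (hab : a < b) (hbc : b < c) (I J : Fin n → ℤ) :
    vpt a c (I + J) ∈ segment ℝ (vpt a b I) (vpt b c J) := by
  have h1 : (0 : ℝ) < (b : ℝ) - a := sub_pos.2 (by exact_mod_cast hab)
  have h2 : (0 : ℝ) < (c : ℝ) - b := sub_pos.2 (by exact_mod_cast hbc)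
  have h3 : (0 : ℝ) < (c : ℝ) - a := by linarith
  refine ⟨((b : ℝ) - a) / (c - a), ((c : ℝ) - b) / (c - a), by positivity, by positivity, ?_, ?_⟩
  · field_simp
    ring
  · ext j
    simp only [vpt, Pi.add_apply, Pi.smul_apply, smul_eq_mul]
    push_cast
    field_simp

/-- A combination with positive weights of nonnegative numbers vanishes only if both do. Hence the
vertex lies on no facet that misses a leaf point, which makes the area finite. -/
theorem homog_vpt_eq_zero (hab : a < b) (hbc : b < c) {I J : Fin n → ℤ} (hI : IsIndex a b I)
    (hJ : IsIndex b c J) {i : Fin (n + 1)} (h : homog 2 (vpt a c (I + J)) i = 0) :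
    homog 2 (vpt a b I) i = 0 ∧ homog 2 (vpt b c J) i = 0 := by
  have h1 : (0 : ℝ) < (b : ℝ) - a := sub_pos.2 (by exact_mod_cast hab)
  have h2 : (0 : ℝ) < (c : ℝ) - b := sub_pos.2 (by exact_mod_cast hbc)
  have h3 := sub_mul_vpt_add hab hbc I J i
  have h4 := homog_nonneg (vpt_mem hab hI) i
  have h5 := homog_nonneg (vpt_mem hbc hJ) i
  rw [h, mul_zero] at h3
  have h6 := mul_nonneg h1.le h4
  have h7 := mul_nonneg h2.le h5
  exact ⟨(mul_eq_zero.1 (by linarith)).resolve_left h1.ne',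
    (mul_eq_zero.1 (by linarith)).resolve_left h2.ne'⟩

/-- The gradient tree from `V_{ab;I}`, `V_{bc;J}` to `V_{ac;I+J}`. -/
def productTree (hab : a < b) (hbc : b < c) {I J : Fin n → ℤ} (hI : IsIndex a b I)
    (hJ : IsIndex b c J) : GradTree (pointGen hab I hI) (pointGen hbc J hJ)
      (pointGen (hab.trans hbc) (I + J) (hI.add hJ)) where
  shift₁ := I
  shift₂ := I + J
  leaf₁ := vpt a b I
  leaf₂ := vpt b c J
  root := vpt a c (I + J)
  leafEdge₁ := expCurve (((b : ℝ) - a) / 2) (vpt a b I) (vpt a c (I + J))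
  leafEdge₂ := expCurve (((c : ℝ) - b) / 2) (vpt b c J) (vpt a c (I + J))
  rootEdge := fun _ => vpt a c (I + J)
  leaf₁_mem := rfl
  leaf₂_mem := rfl
  root_mem := rfl
  trajectory₁ := isTrajectory_expCurve hab (sub_zero I) hI (vpt_mem (hab.trans hbc) (hI.add hJ))
  trajectory₂ := isTrajectory_expCurve hbc (add_sub_cancel_left I J) hJ
    (vpt_mem (hab.trans hbc) (hI.add hJ))
  trajectory₀ := fun t _ => by
    refine ⟨vpt_mem (hab.trans hbc) (hI.add hJ), ?_⟩
    rw [negGrad_sLift (hab.trans hbc), sub_zero, sub_self, smul_zero]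
    exact hasDerivWithinAt_const _ _ _
  tendsto₁ := tendsto_expCurve_atBot (half_pos (sub_pos.2 (by exact_mod_cast hab))) _ _
  tendsto₂ := tendsto_expCurve_atBot (half_pos (sub_pos.2 (by exact_mod_cast hbc))) _ _
  tendsto₀ := tendsto_const_nhds
  meet₁ := expCurve_zero _ _ _
  meet₂ := expCurve_zero _ _ _

/-! ### Every gradient tree with the given leaves is the product tree. -/

section Uniqueness

variable {hab : a < b} {hbc : b < c} {I J : Fin n → ℤ} {hI : IsIndex a b I} {hJ : IsIndex b c J}
  {U : Gen n a c}

theorem GradTree.tendsto_leafEdge₁ (γ : GradTree (pointGen hab I hI) (pointGen hbc J hJ) U) :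
    Tendsto γ.leafEdge₁ atBot (𝓝 (vpt a b I)) :=
  mem_singleton_iff.1 γ.leaf₁_mem ▸ γ.tendsto₁

theorem GradTree.tendsto_leafEdge₂ (γ : GradTree (pointGen hab I hI) (pointGen hbc J hJ) U) :
    Tendsto γ.leafEdge₂ atBot (𝓝 (vpt b c J)) :=
  mem_singleton_iff.1 γ.leaf₂_mem ▸ γ.tendsto₂

theorem GradTree.shift₁_eq (γ : GradTree (pointGen hab I hI) (pointGen hbc J hJ) U) :
    γ.shift₁ = I := by
  simpa using γ.trajectory₁.shift_eq hab γ.tendsto_leafEdge₁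

theorem GradTree.shift₂_eq (γ : GradTree (pointGen hab I hI) (pointGen hbc J hJ) U) :
    γ.shift₂ = I + J := by
  have h := γ.trajectory₂.shift_eq hbc γ.tendsto_leafEdge₂
  rw [γ.shift₁_eq] at h
  exact (sub_eq_iff_eq_add'.1 h)

theorem GradTree.rootEdge_eq (γ : GradTree (pointGen hab I hI) (pointGen hbc J hJ) U) (t : ℝ)
    (ht : 0 ≤ t) : γ.rootEdge t = vpt a c (I + J) := by
  have h := γ.trajectory₀.eq_vpt (hab.trans hbc) γ.tendsto₀ t ht
  rwa [γ.shift₂_eq, sub_zero] at h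

theorem GradTree.root_eq (γ : GradTree (pointGen hab I hI) (pointGen hbc J hJ) U) :
    γ.root = vpt a c (I + J) := by
  refine tendsto_nhds_unique γ.tendsto₀ (tendsto_const_nhds.congr' ?_)
  filter_upwards [Ici_mem_atTop (0 : ℝ)] with t ht using (γ.rootEdge_eq t ht).symm

theorem GradTree.gen_eq (γ : GradTree (pointGen hab I hI) (pointGen hbc J hJ) U) :
    U = pointGen (hab.trans hbc) (I + J) (hI.add hJ) := by
  have h := γ.root_mem
  have hU : U.label = I + J := by
    have h1 := (sLift_eq_iff (hab.trans hbc)).1 (U.graded _ h)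
    rw [γ.root_eq] at h1
    exact (vpt_injective (hab.trans hbc) h1).symm
  rw [U.eq_pointGen (hab.trans hbc)]
  congr 1

theorem GradTree.leafEdge₁_zero (γ : GradTree (pointGen hab I hI) (pointGen hbc J hJ) U) :
    γ.leafEdge₁ 0 = vpt a c (I + J) := γ.meet₁.trans (γ.rootEdge_eq 0 le_rfl)

theorem GradTree.leafEdge₂_zero (γ : GradTree (pointGen hab I hI) (pointGen hbc J hJ) U) :
    γ.leafEdge₂ 0 = vpt a c (I + J) := γ.meet₂.trans (γ.rootEdge_eq 0 le_rfl)

theorem GradTree.same_productTree (γ : GradTree (pointGen hab I hI) (pointGen hbc J hJ) U) :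
    γ.Same (productTree hab hbc hI hJ) := by
  refine ⟨γ.shift₁_eq, γ.shift₂_eq, γ.leaf₁_mem, γ.leaf₂_mem, γ.root_eq, ?_, ?_,
    fun t ht => γ.rootEdge_eq t ht⟩
  · have h := γ.trajectory₁.eqOn_expCurve hab (convex_Iic 0) self_mem_Iic
    rwa [γ.shift₁_eq, γ.leafEdge₁_zero, sub_zero] at h
  · have h := γ.trajectory₂.eqOn_expCurve hbc (convex_Iic 0) self_mem_Iic
    rwa [γ.shift₁_eq, γ.shift₂_eq, γ.leafEdge₂_zero, add_sub_cancel_left] at h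

/-- The root edge is constant and contributes nothing. The value is the same for all trees, so the
representative chosen in a homotopy class is irrelevant. -/
theorem GradTree.area_eq (γ : GradTree (pointGen hab I hI) (pointGen hbc J hJ) U) :
    0 ≤ leafArea a b I (vpt a c (I + J)) + leafArea b c J (vpt a c (I + J)) ∧
    γ.area = ENNReal.ofReal
      (leafArea a b I (vpt a c (I + J)) + leafArea b c J (vpt a c (I + J))) := by
  have h1 := stripArea_leaf hab hI γ.trajectory₁ γ.tendsto_leafEdge₁ fun i hi =>
    (homog_vpt_eq_zero hab hbc hI hJ (γ.leafEdge₁_zero ▸ hi)).1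
  have h2 := stripArea_leaf hbc hJ γ.trajectory₂ γ.tendsto_leafEdge₂ fun i hi =>
    (homog_vpt_eq_zero hab hbc hI hJ (γ.leafEdge₂_zero ▸ hi)).2
  have h0 := stripArea_root (hab.trans hbc) γ.trajectory₀ γ.tendsto₀
  rw [γ.leafEdge₁_zero] at h1
  rw [γ.leafEdge₂_zero] at h2
  refine ⟨add_nonneg h1.1 h2.1, ?_⟩
  rw [GradTree.area, h1.2, h2.2, h0, add_zero, ENNReal.ofReal_add h1.1 h2.1]

theorem GradTree.weight_eq (γ : GradTree (pointGen hab I hI) (pointGen hbc J hJ) U) :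
    γ.weight =
      Real.exp (-(leafArea a b I (vpt a c (I + J)) + leafArea b c J (vpt a c (I + J)))) := by
  obtain ⟨h0, h⟩ := γ.area_eq
  rw [GradTree.weight, h, EReal.coe_ennreal_ofReal, max_eq_left h0, ← EReal.coe_neg,
    EReal.exp_coe, ENNReal.toReal_ofReal (Real.exp_pos _).le]

theorem contDiff_expCurve (k : ℝ) (v m : Fin n → ℝ) : ContDiff ℝ ∞ (expCurve k v m) := by
  unfold expCurve
  fun_prop

/-- All trees agree with `productTree` on the time intervals, and `Same` ignores the curves
elsewhere, so a constant family is a homotopy. -/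
theorem GradTree.homotopic (γ γ' : GradTree (pointGen hab I hI) (pointGen hbc J hJ)
    (pointGen (hab.trans hbc) (I + J) (hI.add hJ))) : γ.Homotopic γ' := by
  have hsymm : ∀ γ : GradTree (pointGen hab I hI) (pointGen hbc J hJ)
      (pointGen (hab.trans hbc) (I + J) (hI.add hJ)), (productTree hab hbc hI hJ).Same γ := by
    intro γ
    obtain ⟨h1, h2, h3, h4, h5, h6, h7, h8⟩ := γ.same_productTree
    exact ⟨h1.symm, h2.symm, h3.symm, h4.symm, h5.symm, h6.symm, h7.symm, h8.symm⟩
  have hunif : ∀ {f : ℝ → Fin n → ℝ} {x : Fin n → ℝ} {l : Filter ℝ}, Tendsto f l (𝓝 x) →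
      TendstoUniformlyOn (fun t (_ : ℝ) => f t) (fun _ => x) l (Icc 0 1) := by
    intro f x l hf
    rw [Metric.tendstoUniformlyOn_iff]
    intro ε hε
    filter_upwards [hf (Metric.ball_mem_nhds x hε)] with t ht _ _
    rw [dist_comm]
    exact ht
  refine ⟨fun _ => productTree hab hbc hI hJ, hsymm γ, hsymm γ', ?_, ?_, ?_,
    hunif (productTree hab hbc hI hJ).tendsto₁, hunif (productTree hab hbc hI hJ).tendsto₂,
    hunif (productTree hab hbc hI hJ).tendsto₀⟩
  · exact ((contDiff_expCurve _ _ _).comp contDiff_snd).contDiffOn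
  · exact ((contDiff_expCurve _ _ _).comp contDiff_snd).contDiffOn
  · exact contDiffOn_const

end Uniqueness

/-! ### The product `m₂` of two generators. -/

theorem degree_eq_zero (hab : a < b) (V : Gen n a b) : V.degree = 0 := by
  have h : V.nonempty.some = vpt a b V.label :=
    (sLift_eq_iff hab).1 (V.graded _ V.nonempty.some_mem)
  have h1 := (subsingleton_singleton.anti (stableManifold_subset hab V.label))
  rw [Gen.degree, h, (vectorSpan_eq_bot_iff_subsingleton _).2 h1]
  simp

theorem m₂_single (hab : a < b) (hbc : b < c) {I J : Fin n → ℤ} (hI : IsIndex a b I)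
    (hJ : IsIndex b c J) :
    m₂ hab hbc (Finsupp.single (pointGen hab I hI) 1) (Finsupp.single (pointGen hbc J hJ) 1) =
      Finsupp.single (pointGen (hab.trans hbc) (I + J) (hI.add hJ))
        ((productTree hab hbc hI hJ).weight : ℂ) := by
  simp only [m₂, Finsupp.linearCombination_single, one_smul, m₂Gen]
  rw [finsum_eq_single _ (pointGen (hab.trans hbc) (I + J) (hI.add hJ))]
  · rw [finsum_eq_single _ (by simp only [degree_eq_zero hab, degree_eq_zero hbc,
      degree_eq_zero (hab.trans hbc)]) fun _ h => (h rfl).elim]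
    rw [finsum_eq_single _ (Quot.mk _ (productTree hab hbc hI hJ)), GradTree.weight_eq,
      GradTree.weight_eq]
    intro g hg
    induction g using Quot.ind with
    | mk γ => exact (hg (Quot.sound (γ.homotopic _))).elim
  · intro U hU
    -- A tree ending at `U` would force `U` to be the generator labelled `I + J`.
    have : IsEmpty (HGT (pointGen hab I hI) (pointGen hbc J hJ) U) :=
      ⟨fun g => hU g.out.gen_eq⟩
    simp [finsum_of_isEmpty]

/-! ## The normalization constants -/

theorem modulus_eq (a b : ℤ) (I : Fin n → ℤ) (x : Fin n → ℝ) :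
    modulus a b I x = ∏ i, √(homog 2 x i / 2) ^ homog (b - a) I i := by
  simp only [modulus, Fin.prod_univ_succ, homog, Fin.cons_zero, Fin.cons_succ]

theorem exp_int_mul_eq_zpow (N : ℤ) (x : ℝ) : Real.exp (N * x) = Real.exp x ^ N := by
  rw [← Real.rpow_intCast, ← Real.exp_mul, mul_comm]

/-- The tangent inequality `x / v ≤ exp(x / v - 1)` raised to the power `N / 2`. The exponent is
linear in `x` with slope `d / 4`, independent of `N`, so the errors cancel in the product over all
homogeneous coordinates. -/
theorem sqrt_zpow_le {x v d : ℝ} {N : ℤ} (hN : 0 ≤ N) (hd : 0 < d) (hx : 0 ≤ x)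
    (hv : v = 2 * N / d) : √(x / 2) ^ N ≤ √(v / 2) ^ N * Real.exp (d / 4 * (x - v)) := by
  -- For `N = 0` also `v = 0`, and the bound is just `1 ≤ exp(d x / 4)`.
  rcases hN.eq_or_lt with rfl | hN
  · have : 0 ≤ d / 4 * (x - v) := by
      rw [hv]
      simp only [Int.cast_zero, mul_zero, zero_div, sub_zero]
      positivity
    simpa using Real.one_le_exp this
  · have hNr : (0 : ℝ) < N := by exact_mod_cast hN
    have hv0 : 0 < v := by rw [hv]; positivity
    have h1 : √(x / 2) ≤ √(v / 2) * Real.exp ((x / v - 1) / 2) := by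
      have h2 : x / 2 ≤ v / 2 * Real.exp (x / v - 1) := by
        have h3 := Real.add_one_le_exp (x / v - 1)
        rw [sub_add_cancel] at h3
        have h4 := mul_le_mul_of_nonneg_left h3 (half_pos hv0).le
        have h5 : v / 2 * (x / v) = x / 2 := by field_simp
        rwa [h5] at h4
      calc √(x / 2) ≤ √(v / 2 * Real.exp (x / v - 1)) := Real.sqrt_le_sqrt h2
        _ = _ := by rw [Real.sqrt_mul (half_pos hv0).le, ← Real.exp_half]
    calc √(x / 2) ^ N ≤ (√(v / 2) * Real.exp ((x / v - 1) / 2)) ^ N :=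
          zpow_le_zpow_left₀ hN.le (Real.sqrt_nonneg _) h1
      _ = _ := by
          rw [mul_zpow, ← exp_int_mul_eq_zpow]
          congr 2
          have h6 : (N : ℝ) = d * v / 2 := by rw [hv]; field_simp
          rw [h6]
          field_simp
          ring

/-- Weighted AM-GM: in the product of the factorwise bounds the exponents sum to zero, both points
having coordinate sum `2`. -/
theorem isGreatest_modulus (hab : a < b) {I : Fin n → ℤ} (hI : IsIndex a b I) :
    IsGreatest (modulus a b I '' polytope n) (modulus a b I (vpt a b I)) := by
  have h : (0 : ℝ) < (b : ℝ) - a := sub_pos.2 (by exact_mod_cast hab)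
  refine ⟨mem_image_of_mem _ (vpt_mem hab hI), ?_⟩
  rintro _ ⟨x, hx, rfl⟩
  rw [modulus_eq, modulus_eq]
  calc ∏ i, √(homog 2 x i / 2) ^ homog (b - a) I i
      ≤ ∏ i, (√(homog 2 (vpt a b I) i / 2) ^ homog (b - a) I i *
          Real.exp (((b : ℝ) - a) / 4 * (homog 2 x i - homog 2 (vpt a b I) i))) :=
        Finset.prod_le_prod (fun i _ => by positivity) fun i _ =>
          sqrt_zpow_le (hI.homog_nonneg i) h (homog_nonneg hx i) (homog_vpt hab I i)
    _ = _ := by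
        rw [Finset.prod_mul_distrib, ← Real.exp_sum, ← Finset.mul_sum, Finset.sum_sub_distrib,
          sum_homog, sum_homog, sub_self, mul_zero, Real.exp_zero, mul_one]

theorem normConst_eq (hab : a < b) {I : Fin n → ℤ} (hI : IsIndex a b I) :
    normConst a b I = Real.exp (-(1 / 2 * ∑ i, ((homog (b - a) I i : ℤ) : ℝ) *
      (Real.log (homog 2 (vpt a b I) i) - Real.log 2))) := by
  have h : (0 : ℝ) < (b : ℝ) - a := sub_pos.2 (by exact_mod_cast hab)
  rw [normConst, (isGreatest_modulus hab hI).csSup_eq, Real.exp_neg, modulus_eq, Finset.mul_sum,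
    Real.exp_sum]
  congr 1
  refine Finset.prod_congr rfl fun i _ => ?_
  rcases (hI.homog_nonneg i).eq_or_lt with h0 | h0
  · simp [← h0]
  · have hv : 0 < homog 2 (vpt a b I) i := by
      rw [homog_vpt hab]
      have : (0 : ℝ) < (homog (b - a) I i : ℤ) := by exact_mod_cast h0
      positivity
    have h1 : √(homog 2 (vpt a b I) i / 2) =
        Real.exp ((Real.log (homog 2 (vpt a b I) i) - Real.log 2) / 2) := by
      rw [Real.exp_half, Real.exp_sub, Real.exp_log hv, Real.exp_log two_pos]
    rw [h1, ← exp_int_mul_eq_zpow]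
    congr 1
    ring

/-- Since homogeneous labels add, the `log 2` terms cancel, and the logarithms at `v_{ac;I+J}` are
those at the vertex in the two leaf areas. -/
theorem normConst_mul (hab : a < b) (hbc : b < c) {I J : Fin n → ℤ} (hI : IsIndex a b I)
    (hJ : IsIndex b c J) :
    normConst a b I * normConst b c J =
      (productTree hab hbc hI hJ).weight * normConst a c (I + J) := by
  rw [GradTree.weight_eq, normConst_eq hab hI, normConst_eq hbc hJ,
    normConst_eq (hab.trans hbc) (hI.add hJ), ← Real.exp_add, ← Real.exp_add, leafArea, leafArea]
  congr 1
  have h : ∀ i, homog (c - a) (I + J) i = homog (b - a) I i + homog (c - b) J i := by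
    intro i
    rw [← homog_add]
    congr 1
    ring
  simp only [h, Finset.mul_sum, ← Finset.sum_neg_distrib, ← Finset.sum_add_distrib]
  refine Finset.sum_congr rfl fun i _ => ?_
  push_cast
  ring

/-! ### The product of the functions `𝐞`. -/

theorem zpow_add_of_nonneg_exponents {R : Type*} [DivisionRing R] (x : R) {p q : ℤ} (hp : 0 ≤ p)
    (hq : 0 ≤ q) : x ^ (p + q) = x ^ p * x ^ q := by
  lift p to ℕ using hp
  lift q to ℕ using hq
  rw [← Nat.cast_add, zpow_natCast, zpow_natCast, zpow_natCast, pow_add]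

/-- Roots and phases have additive exponents, so only the normalization constants need comparing. -/
theorem eHom_comp (hab : a < b) (hbc : b < c) {I J : Fin n → ℤ} (hI : IsIndex a b I)
    (hJ : IsIndex b c J) :
    VPrime.comp (eHom I hI) (eHom J hJ) =
      ((productTree hab hbc hI hJ).weight : ℂ) • eHom (I + J) (hI.add hJ) := by
  refine Subtype.ext (funext fun w => ?_)
  have h : ((normConst a b I * normConst b c J : ℝ) : ℂ) = _ :=
    congrArg _ (normConst_mul hab hbc hI hJ)
  push_cast at h
  change eFun a b I w * eFun b c J w = _ * eFun a c (I + J) w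
  have h0 : c - a - ∑ j, (I + J) j = (b - a - ∑ j, I j) + (c - b - ∑ j, J j) := by
    simp only [Pi.add_apply, Finset.sum_add_distrib]
    ring
  simp only [eFun]
  rw [h0, zpow_add_of_nonneg_exponents _ (sub_nonneg.2 hI.2) (sub_nonneg.2 hJ.2)]
  simp only [Pi.add_apply, fun j => zpow_add_of_nonneg_exponents
    ((√(toBase w j / 2) : ℂ) * ((w j : ℂ) / (‖(w j : ℂ)‖ : ℂ))) (hI.1 j) (hJ.1 j),
    Finset.prod_mul_distrib, ← mul_assoc, ← h]
  ring

end

end MorseCPn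

theorem lemma5p5 (n : ℕ) (a b c : ℤ) (hab : a < b) (hbc : b < c) (I J : Fin n → ℤ)
    (hI : IsIndex a b I) (hJ : IsIndex b c J) :
    -- the product formula
    iota (hab.trans hbc).le
        (m₂ hab hbc (Finsupp.single (pointGen hab I hI) 1) (Finsupp.single (pointGen hbc J hJ) 1)) =
      VPrime.comp (eHom I hI) (eHom J hJ) ∧
    -- the gradient tree
    vpt a c (I + J) ∈ segment ℝ (vpt a b I) (vpt b c J) ∧
    ∃ γ : GradTree (pointGen hab I hI) (pointGen hbc J hJ)
        (pointGen (hab.trans hbc) (I + J) (hI.add hJ)),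
      insert γ.leaf₁ (γ.leafEdge₁ '' Set.Iic 0) = segment ℝ (vpt a b I) (vpt a c (I + J)) ∧
      insert γ.leaf₂ (γ.leafEdge₂ '' Set.Iic 0) = segment ℝ (vpt b c J) (vpt a c (I + J)) ∧
      (∀ t, 0 ≤ t → γ.rootEdge t = vpt a c (I + J)) ∧
      (∀ (U : Gen n a c) (γ' : GradTree (pointGen hab I hI) (pointGen hbc J hJ) U),
        U = pointGen (hab.trans hbc) (I + J) (hI.add hJ) ∧ γ'.Same γ) ∧
      -- its weight
      γ.area ≠ ⊤ ∧
      m₂ hab hbc (Finsupp.single (pointGen hab I hI) 1) (Finsupp.single (pointGen hbc J hJ) 1) =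
        Finsupp.single (pointGen (hab.trans hbc) (I + J) (hI.add hJ)) (γ.weight : ℂ) ∧
      VPrime.comp (eHom I hI) (eHom J hJ) = (γ.weight : ℂ) • eHom (I + J) (hI.add hJ) := by
  refine ⟨?_, vpt_add_mem_segment hab hbc I J, productTree hab hbc hI hJ,
    insert_image_expCurve (half_pos (sub_pos.2 (by exact_mod_cast hab))) _ _,
    insert_image_expCurve (half_pos (sub_pos.2 (by exact_mod_cast hbc))) _ _,
    fun _ _ => rfl, fun U γ' => ⟨γ'.gen_eq, γ'.same_productTree⟩, ?_,
    m₂_single hab hbc hI hJ, eHom_comp hab hbc hI hJ⟩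
  · rw [m₂_single, eHom_comp hab hbc, iota, Finsupp.linearCombination_single]
    rfl
  · rw [(productTree hab hbc hI hJ).area_eq.2]
    exact ENNReal.ofReal_ne_top
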